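/- Let $\mathcal P$ be a family of probability measures on a measurable space $\Omega$, let $T:\mathcal P\to\mathbb R$ and $P\in\mathcal P$. For $g\in L_2(P)$ a path $s\mapsto P_{g,s}$ of probability measures, with $P_{g,s}\in\mathcal P$ for small $s>0$, has tangent $g$ if $\sqrt{dP_{g,s}}=(1+\tfrac s2 g)\sqrt{dP}+o(s)$ in $L_2$ as $s\downarrow0$. The tangent set $\hat{\mathcal G}$ consists of all $g\in L_2(P)$ with $\int g\,dP=0$ that are the tangent of some such path; fix one such path $(P_{g,s})_{s>0}$ for each $g\in\hat{\mathcal G}$. Assume that $\hat{\mathcal G}$ is a closed convex cone with vertex at $0$, and that $T$ is differentiable at $P$ with gradient $\kappa\in L_2(P)$: for all $g\in\hat{\mathcal G}$, $T(P_{g,s})=T(P)+s\langle\kappa|g\rangle+o(s)$ as $s\downarrow0$. Let $\hat\kappa$ be the best approximation of $\kappa$ in $\hat{\mathcal G}$ (projection in $L_2(P)$). For $\alpha\in(0,1)$ let $\Phi(-u_\alpha)=\alpha$, with $\Phi$ the standard normal distribution function, and let $$\hat\tau_n(x_1,\dots,x_n)=\mathbf 1\Bigl\{\tfrac1{\sqrt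 n}\sum_{i=1}^n\hat\kappa(x_i)>\|\hat\kappa\|\,u_\alpha\Bigr\},$$ where any measurable version of $\hat\kappa$ may be used. Let $\hat J$ be the null hypothesis consisting of all sequences $Q_n=P_{g,t/\sqrt n}$, $n\ge1$, with $g\in\hat{\mathcal G}$, $t\in(0,\infty)$, for which $\lim_{n\to\infty}\sqrt n\,\bigl(T(Q_n)-T(P)\bigr)=0$. Suppose that some $g_0\in\hat{\mathcal G}$ satisfies $\langle\kappa|g_0\rangle\le0<\langle\hat\kappa|g_0\rangle$. Then $$\sup_{(Q_n)\in\hat J}\ \liminf_{n\to\infty}\int\hat\tau_n\,dQ_n^{\,n}=1,$$ that is, the level of $\hat\tau$ breaks down completely on $\hat J$. -/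

import Mathlib

open MeasureTheory ProbabilityTheory Filter Topology

namespace OneSided

variable {Ω : Type*} [MeasurableSpace Ω]

/-- The `L²`-distance `‖√dQ - (1 + h) √dP‖`, computed with respect to the dominating measure
`P + Q` (its value does not depend on the choice of the dominating measure). -/
noncomputable def hellingerRemainder (P Q : ProbabilityMeasure Ω) (h : Ω → ℝ) : ENNReal :=
  eLpNorm
    (fun x => √((Q : Measure Ω).rnDeriv ((P : Measure Ω) + (Q : Measure Ω)) x).toReal
      - (1 + h x) * √((P : Measure Ω).rnDeriv ((P : Measure Ω) + (Q : Measure Ω)) x).toReal)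
    2 ((P : Measure Ω) + (Q : Measure Ω))

/-- `s ↦ path s` (only small `s > 0` matter) is a path of local alternatives at `P` within the
family `𝓜` with tangent `g`: it stays in `𝓜` for small `s > 0`, and
`√d(path s) = (1 + (s/2) g) √dP + o(s)` in `L²` as `s ↓ 0`. -/
def IsLocalPath (𝓜 : Set (ProbabilityMeasure Ω)) (P : ProbabilityMeasure Ω)
    (g : Lp ℝ 2 (P : Measure Ω)) (path : ℝ → ProbabilityMeasure Ω) : Prop :=
  (∀ᶠ s in 𝓝[>] (0 : ℝ), path s ∈ 𝓜) ∧
    Tendsto (fun s : ℝ => hellingerRemainder P (path s) (fun x => s / 2 * g x) / ENNReal.ofReal s)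
      (𝓝[>] (0 : ℝ)) (𝓝 0)

/-- The tangent set of `𝓜` at `P`: all `g ∈ L²(P)`, `g ⊥ 1`, that are the tangent of some path of
local alternatives at `P` within `𝓜`. -/
def tangentSet (𝓜 : Set (ProbabilityMeasure Ω)) (P : ProbabilityMeasure Ω) :
    Set (Lp ℝ 2 (P : Measure Ω)) :=
  {g | ∫ x, g x ∂(P : Measure Ω) = 0 ∧ ∃ path, IsLocalPath 𝓜 P g path}

/-- `T` is differentiable at `P` with gradient `κ` along the paths `s ↦ path g s`, `g ∈ G`:
`T (path g s) = T P + s ⟨κ|g⟩ + o(s)` as `s ↓ 0`. -/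
def HasGradient (T : ProbabilityMeasure Ω → ℝ) (P : ProbabilityMeasure Ω)
    (G : Set (Lp ℝ 2 (P : Measure Ω)))
    (path : Lp ℝ 2 (P : Measure Ω) → ℝ → ProbabilityMeasure Ω)
    (κ : Lp ℝ 2 (P : Measure Ω)) : Prop :=
  ∀ g ∈ G, (fun s : ℝ => T (path g s) - (T P + s * inner ℝ κ g)) =o[𝓝[>] (0 : ℝ)] fun s => s

/-- `κhat` is a best approximation of `κ` in `G`. -/
def IsBestApprox {E : Type*} [NormedAddCommGroup E] (G : Set E) (κ κhat : E) : Prop :=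
  κhat ∈ G ∧ ∀ g ∈ G, ‖κ - κhat‖ ≤ ‖κ - g‖

/-- The null hypothesis `J`: all sequences `Q_n = path g (t / √n)` with `g ∈ G`, `t > 0`, such that
`√n (T Q_n - T P) → 0`. -/
def nullJ (T : ProbabilityMeasure Ω → ℝ) (P : ProbabilityMeasure Ω)
    (G : Set (Lp ℝ 2 (P : Measure Ω)))
    (path : Lp ℝ 2 (P : Measure Ω) → ℝ → ProbabilityMeasure Ω) :
    Set (ℕ → ProbabilityMeasure Ω) :=
  {Q | (∃ g ∈ G, ∃ t : ℝ, 0 < t ∧ Q = fun n : ℕ => path g (t / √(n : ℝ))) ∧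
    Tendsto (fun n : ℕ => √(n : ℝ) * (T (Q n) - T P)) atTop (𝓝 0)}

/-- The test at sample size `n` that rejects iff `n^{-1/2} ∑ k(x_i) > c`. -/
noncomputable def sumTest (k : Ω → ℝ) (c : ℝ) (n : ℕ) : (Fin n → Ω) → ℝ :=
  Set.indicator {x | c < 1 / √(n : ℝ) * ∑ i, k (x i)} fun _ => 1

/-- The expectation `∫ τ_n dQ^n` of a test at sample size `n` under `n` i.i.d. observations from
`Q`. -/
noncomputable def rejectionProb {n : ℕ} (τ : (Fin n → Ω) → ℝ) (Q : ProbabilityMeasure Ω) : ℝ :=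
  ∫ x, τ x ∂(Measure.pi fun _ : Fin n => (Q : Measure Ω))

end OneSided

/-! ### Comparing expectations under `P` and under `Q`. -/

namespace OneSided

/-! The test looks in the direction `κhat`, while the null hypothesis only constrains `⟨κ|g⟩`.
Projection onto a cone gives `⟨κ|κhat⟩ = ‖κhat‖²` (`IsBestApprox.inner_self_eq`), so adding a
nonnegative multiple of `κhat` to `g₀` yields `g` in the cone with `⟨κ|g⟩ = 0 < ⟨κhat|g⟩`. Along `g`
every `t > 0` gives a null sequence (`mem_nullJ_of_inner_eq_zero`), yet the test statistic drifts by
`t⟨κhat|g⟩`, which exceeds any fixed critical value as `t → ∞`.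

No limit law is needed, since only power tending to 1 is claimed. `one_sub_le_rejectionProb` applies
Chebyshev to the sum truncated at `√n`. Its ingredients under `Q_n` (tail, second moment, mean) are
transferred to `P` by expanding `q²` with `q = (1 + (s/2) g) p + r` for the root densities `p`, `q`.
The resulting bound in `le_liminf_rejectionProb` has lossy constants, but they do not depend on `t`
and vanish in the limit. -/

/-- A pointwise lower bound for `f dQ` by `φ dP` up to a multiple of the squared remainder of the
root densities integrates to a bound for the expectations. -/
lemma integral_sub_le_integral_of_pointwise {Ω : Type*} [MeasurableSpace Ω]
    (P Q : ProbabilityMeasure Ω) {h f φ : Ω → ℝ} (C : ℝ) (hh : Measurable h)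
    (hρ : hellingerRemainder P Q h ≠ ⊤)
    (hf : Integrable f (Q : Measure Ω)) (hφ : Integrable φ (P : Measure Ω))
    (hle : ∀ x p q : ℝ, ∀ y : Ω, 0 ≤ p → 0 ≤ q → x = q - (1 + h y) * p →
      φ y * p ^ 2 - C * x ^ 2 ≤ f y * q ^ 2) :
    ∫ x, φ x ∂(P : Measure Ω) - C * (hellingerRemainder P Q h).toReal ^ 2
      ≤ ∫ x, f x ∂(Q : Measure Ω) := by
  set μ : Measure Ω := (P : Measure Ω) + (Q : Measure Ω) with hμ
  have hPμ : (P : Measure Ω) ≪ μ := Measure.AbsolutelyContinuous.rfl.add_right _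
  have hQμ : (Q : Measure Ω) ≪ μ := by
    rw [hμ, add_comm]; exact Measure.AbsolutelyContinuous.rfl.add_right _
  set p : Ω → ℝ := fun x => √((P : Measure Ω).rnDeriv μ x).toReal with hp
  set q : Ω → ℝ := fun x => √((Q : Measure Ω).rnDeriv μ x).toReal with hq
  set r : Ω → ℝ := fun x => q x - (1 + h x) * p x with hr
  have hpm : Measurable p := by fun_prop
  have hqm : Measurable q := by fun_prop
  have hrm : Measurable r := by fun_prop
  have hρr : hellingerRemainder P Q h = eLpNorm r 2 μ := rfl
  have hrL : MemLp r 2 μ := ⟨hrm.aestronglyMeasurable, by rw [← hρr]; exact hρ.lt_top⟩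
  have hr2 : ∫ x, r x ^ 2 ∂μ = (hellingerRemainder P Q h).toReal ^ 2 := by
    rw [hρr, hrL.eLpNorm_eq_integral_rpow_norm (by norm_num) (by norm_num),
      ENNReal.toReal_ofReal (by positivity)]
    simp only [ENNReal.toReal_ofNat, Real.rpow_ofNat, Real.norm_eq_abs, sq_abs]
    rw [← one_div, ← Real.sqrt_eq_rpow, Real.sq_sqrt (integral_nonneg fun _ => sq_nonneg _)]
  have hp2 : ∀ x, p x ^ 2 = ((P : Measure Ω).rnDeriv μ x).toReal := fun x =>
    Real.sq_sqrt ENNReal.toReal_nonneg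
  have hq2 : ∀ x, q x ^ 2 = ((Q : Measure Ω).rnDeriv μ x).toReal := fun x =>
    Real.sq_sqrt ENNReal.toReal_nonneg
  have hφi : Integrable (fun x => φ x * p x ^ 2) μ := by
    refine ((integrable_rnDeriv_smul_iff hPμ).2 hφ).congr (.of_forall fun x => ?_)
    simp only [hp2, smul_eq_mul, mul_comm]
  have hfi : Integrable (fun x => f x * q x ^ 2) μ := by
    refine ((integrable_rnDeriv_smul_iff hQμ).2 hf).congr (.of_forall fun x => ?_)
    simp only [hq2, smul_eq_mul, mul_comm]
  have hφe : ∫ x, φ x * p x ^ 2 ∂μ = ∫ x, φ x ∂(P : Measure Ω) := by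
    rw [← integral_rnDeriv_smul hPμ]
    simp only [hp2, smul_eq_mul, mul_comm]
  have hfe : ∫ x, f x * q x ^ 2 ∂μ = ∫ x, f x ∂(Q : Measure Ω) := by
    rw [← integral_rnDeriv_smul hQμ]
    simp only [hq2, smul_eq_mul, mul_comm]
  rw [← hφe, ← hfe, ← hr2, ← integral_const_mul, ← integral_sub hφi (hrL.integrable_sq.const_mul C)]
  exact integral_mono (hφi.sub (hrL.integrable_sq.const_mul C)) hfi fun x =>
    hle (r x) (p x) (q x) x (Real.sqrt_nonneg _) (Real.sqrt_nonneg _) rfl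

variable {Ω : Type*} [MeasurableSpace Ω]

/-- A first order lower bound for the expectation of a bounded function along a path with
tangent `g`. -/
lemma le_integral_of_hellingerRemainder (P Q : ProbabilityMeasure Ω) {g f : Ω → ℝ} {s B δ : ℝ}
    (hg : Measurable g) (hgL : MemLp g 2 (P : Measure Ω))
    (hρ : hellingerRemainder P Q (fun x => s / 2 * g x) ≠ ⊤)
    (hf : Measurable f) (hB : ∀ x, |f x| ≤ B) (hδ : 0 < δ) :
    ∫ x, f x ∂(P : Measure Ω) + s * ∫ x, f x * g x ∂(P : Measure Ω)
        - δ * ∫ x, f x ^ 2 ∂(P : Measure Ω)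
        - s ^ 2 / 2 * ∫ x, |f x| * g x ^ 2 ∂(P : Measure Ω)
        - (δ⁻¹ + 2 * B) * (hellingerRemainder P Q (fun x => s / 2 * g x)).toReal ^ 2
      ≤ ∫ x, f x ∂(Q : Measure Ω) := by
  have hbdd : ∀ μ : Measure Ω, ∀ᵐ x ∂μ, ‖f x‖ ≤ B := fun μ => .of_forall hB
  have hfP : MemLp f ⊤ (P : Measure Ω) := memLp_top_of_bound hf.aestronglyMeasurable B (hbdd _)
  have hfQ : MemLp f ⊤ (Q : Measure Ω) := memLp_top_of_bound hf.aestronglyMeasurable B (hbdd _)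
  have i1 : Integrable f (P : Measure Ω) := hfP.integrable le_top
  have i2 : Integrable (fun x => f x * g x) (P : Measure Ω) :=
    (hgL.integrable one_le_two).bdd_mul hf.aestronglyMeasurable (hbdd _)
  have i3 : Integrable (fun x => f x ^ 2) (P : Measure Ω) :=
    (hfP.mono_exponent le_top).integrable_sq
  have i4 : Integrable (fun x => |f x| * g x ^ 2) (P : Measure Ω) :=
    hgL.integrable_sq.bdd_mul (c := B) (by fun_prop) (.of_forall fun x => by simpa using hB x)
  have j1 : Integrable (fun x => f x + s * (f x * g x)) (P : Measure Ω) := i1.add (i2.const_mul s)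
  have j2 : Integrable (fun x => f x + s * (f x * g x) - δ * f x ^ 2) (P : Measure Ω) :=
    j1.sub (i3.const_mul δ)
  have key := integral_sub_le_integral_of_pointwise P Q (h := fun x => s / 2 * g x) (f := f)
    (φ := fun x => f x + s * (f x * g x) - δ * f x ^ 2 - s ^ 2 / 2 * (|f x| * g x ^ 2))
    (δ⁻¹ + 2 * B) (by fun_prop) hρ (hfQ.integrable le_top)
    (j2.sub (i4.const_mul _)) ?_
  · rwa [integral_sub j2 (i4.const_mul _), integral_sub j1 (i3.const_mul δ),
      integral_add i1 (i2.const_mul s),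
      integral_const_mul, integral_const_mul, integral_const_mul] at key
  · intro r p q y _ _ hr
    have hq : q = (1 + s / 2 * g y) * p + r := by linarith
    -- The term linear in `r` is split by Young's inequality; the weight `δ` is left free and
    -- becomes `1/√n` later.
    have e1 : -(δ * f y ^ 2 * p ^ 2 + δ⁻¹ * r ^ 2) ≤ 2 * (f y * p * r) := by
      have : 0 ≤ δ⁻¹ * (δ * (f y * p) + r) ^ 2 := by positivity
      have h2 : δ⁻¹ * (δ * (f y * p) + r) ^ 2
          = δ * f y ^ 2 * p ^ 2 + δ⁻¹ * r ^ 2 + 2 * (f y * p * r) := by field_simp; ring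
      linarith
    have e2 : -(|f y| * (s / 2 * g y * p + r) ^ 2) ≤ f y * (s / 2 * g y * p + r) ^ 2 := by
      rw [← neg_mul]; exact mul_le_mul_of_nonneg_right (neg_abs_le _) (sq_nonneg _)
    have e3 : |f y| * (s / 2 * g y * p + r) ^ 2
        ≤ |f y| * (2 * (s / 2 * g y * p) ^ 2) + B * (2 * r ^ 2) := by
      have h1 : (s / 2 * g y * p + r) ^ 2 ≤ 2 * (s / 2 * g y * p) ^ 2 + 2 * r ^ 2 := by
        nlinarith [sq_nonneg (s / 2 * g y * p - r)]
      have h2 := mul_le_mul_of_nonneg_left h1 (abs_nonneg (f y))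
      have h3 := mul_le_mul_of_nonneg_right (hB y) (by positivity : 0 ≤ 2 * r ^ 2)
      linarith
    -- Square of `q = p + ((s/2) g p + r)`; the last two summands cancel each other.
    have e4 : f y * q ^ 2 = f y * p ^ 2 + s * (f y * g y) * p ^ 2 + 2 * (f y * p * r)
        + f y * (s / 2 * g y * p + r) ^ 2 + s * g y * p * f y * r - s * g y * p * f y * r := by
      rw [hq]; ring
    have e5 : |f y| * (2 * (s / 2 * g y * p) ^ 2) = s ^ 2 / 2 * (|f y| * g y ^ 2) * p ^ 2 := by ring
    nlinarith

/-- An upper bound for the expectation of a nonnegative bounded function along a path with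
tangent `g`. -/
lemma integral_le_of_hellingerRemainder (P Q : ProbabilityMeasure Ω) {g f : Ω → ℝ} {s B : ℝ}
    (hg : Measurable g) (hgL : MemLp g 2 (P : Measure Ω))
    (hρ : hellingerRemainder P Q (fun x => s / 2 * g x) ≠ ⊤)
    (hf : Measurable f) (hf0 : ∀ x, 0 ≤ f x) (hB : ∀ x, f x ≤ B) :
    ∫ x, f x ∂(Q : Measure Ω) ≤
      3 * ∫ x, f x ∂(P : Measure Ω) + 3 / 4 * s ^ 2 * ∫ x, f x * g x ^ 2 ∂(P : Measure Ω)
        + 3 * B * (hellingerRemainder P Q (fun x => s / 2 * g x)).toReal ^ 2 := by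
  have hbdd : ∀ μ : Measure Ω, ∀ᵐ x ∂μ, ‖f x‖ ≤ B := fun μ => .of_forall fun x => by
    rw [Real.norm_of_nonneg (hf0 x)]; exact hB x
  have hfP : MemLp f ⊤ (P : Measure Ω) := memLp_top_of_bound hf.aestronglyMeasurable B (hbdd _)
  have hfQ : MemLp f ⊤ (Q : Measure Ω) := memLp_top_of_bound hf.aestronglyMeasurable B (hbdd _)
  have i1 : Integrable f (P : Measure Ω) := hfP.integrable le_top
  have i2 : Integrable (fun x => f x * g x ^ 2) (P : Measure Ω) :=
    hgL.integrable_sq.bdd_mul hf.aestronglyMeasurable (hbdd _)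
  have key := integral_sub_le_integral_of_pointwise P Q (h := fun x => s / 2 * g x)
    (f := fun x => - f x) (φ := fun x => -(3 * f x + 3 / 4 * s ^ 2 * (f x * g x ^ 2)))
    (3 * B) (by fun_prop) hρ (hfQ.integrable le_top).neg
    ((i1.const_mul _).add (i2.const_mul _)).neg ?_
  · rw [integral_neg, integral_neg, integral_add (i1.const_mul _) (i2.const_mul _),
      integral_const_mul, integral_const_mul] at key
    linarith
  · intro r p q y _ _ hr
    have hq : q = p + s / 2 * g y * p + r := by linarith
    have h1 : q ^ 2 ≤ 3 * (p ^ 2 + (s / 2 * g y * p) ^ 2 + r ^ 2) := by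
      rw [hq]
      nlinarith [sq_nonneg (p - s / 2 * g y * p), sq_nonneg (p - r),
        sq_nonneg (s / 2 * g y * p - r)]
    have h2 := mul_le_mul_of_nonneg_left h1 (hf0 y)
    have h3 := mul_le_mul_of_nonneg_right (hB y) (sq_nonneg r)
    nlinarith

end OneSided

/-! ### Chebyshev's inequality for the truncated sum. -/

namespace OneSided

variable {Ω : Type*} [MeasurableSpace Ω]

/-- Chebyshev's inequality for the truncated sum bounds the rejection probability from below. -/
lemma one_sub_le_rejectionProb (Q : ProbabilityMeasure Ω) {k : Ω → ℝ} (hk : Measurable k)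
    {n : ℕ} (hn : 0 < n) {c b : ℝ}
    (hc : c < √n * ∫ x, {x | |k x| ≤ b}.indicator k x ∂(Q : Measure Ω)) :
    1 - n * (Q : Measure Ω).real {x | b < |k x|}
        - (∫ x, {x | |k x| ≤ b}.indicator k x ^ 2 ∂(Q : Measure Ω))
          / (√n * ∫ x, {x | |k x| ≤ b}.indicator k x ∂(Q : Measure Ω) - c) ^ 2
      ≤ rejectionProb (sumTest k c n) Q := by
  set h : Ω → ℝ := {x | |k x| ≤ b}.indicator k with hh
  have hset : MeasurableSet {x | |k x| ≤ b} := measurableSet_le (by fun_prop) measurable_const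
  have hset' : MeasurableSet {x | b < |k x|} := measurableSet_lt measurable_const (by fun_prop)
  have hhm : Measurable h := hk.indicator hset
  -- `b` may be negative, in which case the truncation is identically 0.
  have hhb : ∀ x, |h x| ≤ max b 0 := by
    intro x
    by_cases hx : |k x| ≤ b
    · rw [hh, Set.indicator_of_mem (by exact hx)]; exact le_max_of_le_left hx
    · rw [hh, Set.indicator_of_notMem (by exact hx)]; simp
  have hhL : MemLp h 2 (Q : Measure Ω) :=
    (memLp_top_of_bound hhm.aestronglyMeasurable _ (.of_forall hhb)).mono_exponent le_top
  set m := ∫ x, h x ∂(Q : Measure Ω) with hm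
  set ν := Measure.pi fun _ : Fin n => (Q : Measure Ω) with hν
  set S : (Fin n → Ω) → ℝ := ∑ i, fun x => h (x i) with hS
  have hcomp : ∀ i : Fin n, MemLp (fun x : Fin n → Ω => h (x i)) 2 ν := fun i =>
    hhL.comp_measurePreserving (measurePreserving_eval (fun _ : Fin n => (Q : Measure Ω)) i)
  have hSL : MemLp S 2 ν := memLp_finsetSum' _ fun i _ => hcomp i
  have hSe : ∫ x, S x ∂ν = n * m := by
    simp only [hS, Finset.sum_apply]
    rw [integral_finsetSum _ fun i _ => (hcomp i).integrable one_le_two]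
    simp [hν, integral_comp_eval (μ := fun _ : Fin n => (Q : Measure Ω)) (f := h)
      hhm.aestronglyMeasurable, hm]
  have hSv : variance S ν ≤ n * ∫ x, h x ^ 2 ∂(Q : Measure Ω) := by
    rw [hS, hν, variance_sum_pi fun _ => hhL]
    simp only [Finset.sum_const, Finset.card_univ, Fintype.card_fin, nsmul_eq_mul]
    gcongr
    exact variance_le_expectation_sq hhm.aestronglyMeasurable
  have hn' : (0 : ℝ) < √n := Real.sqrt_pos.2 (by exact_mod_cast hn)
  have hnn : √(n : ℝ) * √n = n := Real.mul_self_sqrt (Nat.cast_nonneg n)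
  have hd : 0 < √n * m - c := sub_pos.2 hc
  set R : Set (Fin n → Ω) := {x | c < 1 / √(n : ℝ) * ∑ i, k (x i)} with hR
  have hRm : MeasurableSet R := measurableSet_lt measurable_const (by fun_prop)
  have hrej : rejectionProb (sumTest k c n) Q = ν.real R := by
    rw [rejectionProb, sumTest, integral_indicator_const _ hRm, smul_eq_mul, mul_one]
  set D : Set (Fin n → Ω) := {x | √n * (√n * m - c) ≤ |S x - ∫ y, S y ∂ν|} with hD
  have hDle : ν.real D ≤ (∫ x, h x ^ 2 ∂(Q : Measure Ω)) / (√n * m - c) ^ 2 := by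
    have h1 : ν.real D ≤ variance S ν / (√n * (√n * m - c)) ^ 2 :=
      ENNReal.toReal_le_of_le_ofReal (div_nonneg (variance_nonneg _ _) (sq_nonneg _))
        (meas_ge_le_variance_div_sq hSL (mul_pos hn' hd))
    refine h1.trans ?_
    rw [mul_pow, Real.sq_sqrt (Nat.cast_nonneg n), div_le_div_iff₀ (by positivity) (by positivity)]
    nlinarith [mul_le_mul_of_nonneg_right hSv (sq_nonneg (√n * m - c))]
  have hEle : ν.real (⋃ i, {x | b < |k (x i)|}) ≤ n * (Q : Measure Ω).real {x | b < |k x|} := by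
    refine (measureReal_iUnion_fintype_le _).trans ?_
    have : ∀ i : Fin n, ν.real {x | b < |k (x i)|} = (Q : Measure Ω).real {x | b < |k x|} :=
      fun i => (measurePreserving_eval (fun _ : Fin n => (Q : Measure Ω)) i).measureReal_preimage
        hset'.nullMeasurableSet
    simp [this]
  -- If no observation exceeds `b`, truncation changes nothing, and acceptance puts the sum at most
  -- `√n c`, hence at least `√n (√n m - c)` below its mean `n m`.
  have hsub : Rᶜ ⊆ (⋃ i, {x : Fin n → Ω | b < |k (x i)|}) ∪ D := by
    intro x hx
    by_cases hE : ∃ i, b < |k (x i)|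
    · exact Or.inl (Set.mem_iUnion.2 hE)
    refine Or.inr ?_
    push Not at hE
    have hSk : S x = ∑ i, k (x i) := by
      simp only [hS, Finset.sum_apply]
      exact Finset.sum_congr rfl fun i _ => Set.indicator_of_mem (show x i ∈ {x | |k x| ≤ b} from hE i) k
    have hx' : 1 / √(n : ℝ) * ∑ i, k (x i) ≤ c := not_lt.1 hx
    rw [← hSk, one_div, inv_mul_le_iff₀ hn'] at hx'
    change _ ≤ |S x - ∫ y, S y ∂ν|
    rw [hSe, abs_sub_comm]
    refine le_trans ?_ (le_abs_self _)
    rw [mul_sub, ← mul_assoc, hnn]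
    linarith
  have hcompl : ν.real Rᶜ = 1 - ν.real R := probReal_compl_eq_one_sub hRm
  have := (measureReal_mono (μ := ν) hsub).trans (measureReal_union_le _ _)
  rw [hrej]
  linarith

lemma rejectionProb_sumTest_mem_Icc (k : Ω → ℝ) (c : ℝ) (n : ℕ) (Q : ProbabilityMeasure Ω) :
    rejectionProb (sumTest k c n) Q ∈ Set.Icc (0 : ℝ) 1 := by
  have h0 : ∀ x, 0 ≤ sumTest k c n x := fun x => Set.indicator_nonneg (fun _ _ => zero_le_one) x
  have h1 : ∀ x, sumTest k c n x ≤ 1 := fun x =>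
    Set.indicator_apply_le' (fun _ => le_rfl) fun _ => zero_le_one
  refine ⟨integral_nonneg h0, ?_⟩
  have := integral_mono_of_nonneg (μ := Measure.pi fun _ : Fin n => (Q : Measure Ω))
    (.of_forall h0) (integrable_const (1 : ℝ)) (.of_forall h1)
  simpa [rejectionProb] using this

end OneSided

/-! ### Limits under truncation at level `√n`, by dominated convergence. -/

namespace OneSided

variable {Ω : Type*}

lemma eventually_abs_le_sqrt (a : ℝ) : ∀ᶠ n : ℕ in atTop, |a| ≤ √(n : ℝ) :=
  (Real.tendsto_sqrt_atTop.comp tendsto_natCast_atTop_atTop).eventually_ge_atTop _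

/-- Truncation of `k` at level `√n`. -/
noncomputable def truncSqrt (k : Ω → ℝ) (n : ℕ) : Ω → ℝ := {x | |k x| ≤ √(n : ℝ)}.indicator k

/-- Indicator of the event that `k` exceeds the truncation level `√n`. -/
noncomputable def tailSqrt (k : Ω → ℝ) (n : ℕ) : Ω → ℝ :=
  {x | √(n : ℝ) < |k x|}.indicator fun _ => 1

lemma eventually_truncSqrt_eq (k : Ω → ℝ) (x : Ω) :
    ∀ᶠ n : ℕ in atTop, truncSqrt k n x = k x := by
  filter_upwards [eventually_abs_le_sqrt (k x)] with n hn
  exact Set.indicator_of_mem (show x ∈ {x | |k x| ≤ √(n : ℝ)} from hn) k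

lemma eventually_tailSqrt_eq (k : Ω → ℝ) (x : Ω) :
    ∀ᶠ n : ℕ in atTop, tailSqrt k n x = 0 := by
  filter_upwards [eventually_abs_le_sqrt (k x)] with n hn
  exact Set.indicator_of_notMem (show x ∉ {x | √(n : ℝ) < |k x|} from not_lt.2 hn) _

lemma abs_truncSqrt_le (k : Ω → ℝ) (n : ℕ) (x : Ω) : |truncSqrt k n x| ≤ |k x| := by
  simp only [truncSqrt, Set.indicator_apply]
  split_ifs <;> simp

lemma abs_truncSqrt_le_sqrt (k : Ω → ℝ) (n : ℕ) (x : Ω) : |truncSqrt k n x| ≤ √(n : ℝ) := by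
  simp only [truncSqrt, Set.indicator_apply]
  split_ifs with h
  · exact h
  · simp

lemma truncSqrt_sq_le (k : Ω → ℝ) (n : ℕ) (x : Ω) : truncSqrt k n x ^ 2 ≤ n := by
  have := pow_le_pow_left₀ (abs_nonneg _) (abs_truncSqrt_le_sqrt k n x) 2
  rwa [sq_abs, Real.sq_sqrt (Nat.cast_nonneg n)] at this

lemma tailSqrt_nonneg (k : Ω → ℝ) (n : ℕ) (x : Ω) : 0 ≤ tailSqrt k n x :=
  Set.indicator_nonneg (fun _ _ => zero_le_one) x

lemma tailSqrt_le_one (k : Ω → ℝ) (n : ℕ) (x : Ω) : tailSqrt k n x ≤ 1 :=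
  Set.indicator_apply_le' (fun _ => le_rfl) fun _ => zero_le_one

/-- Provides the dominating function `k²` when the tail is scaled by `n`. -/
lemma mul_tailSqrt_le_sq (k : Ω → ℝ) (n : ℕ) (x : Ω) : n * tailSqrt k n x ≤ k x ^ 2 := by
  simp only [tailSqrt, Set.indicator_apply]
  split_ifs with h
  · rw [mul_one, ← sq_abs, ← Real.sq_sqrt (Nat.cast_nonneg (α := ℝ) n)]
    exact pow_le_pow_left₀ (Real.sqrt_nonneg _) (le_of_lt h) 2
  · simpa using sq_nonneg (k x)

lemma sqrt_mul_abs_sub_truncSqrt_le (k : Ω → ℝ) (n : ℕ) (x : Ω) :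
    √(n : ℝ) * |truncSqrt k n x - k x| ≤ k x ^ 2 := by
  simp only [truncSqrt, Set.indicator_apply]
  split_ifs with h
  · simpa using sq_nonneg (k x)
  · have h' : √(n : ℝ) ≤ |k x| := (not_le.1 h).le
    rw [zero_sub, abs_neg, ← sq_abs, sq]
    exact mul_le_mul_of_nonneg_right h' (abs_nonneg _)

variable [MeasurableSpace Ω] {μ : Measure Ω} {k g : Ω → ℝ}

lemma measurable_truncSqrt (hk : Measurable k) (n : ℕ) : Measurable (truncSqrt k n) :=
  hk.indicator (measurableSet_le (by fun_prop) measurable_const)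

lemma measurable_tailSqrt (hk : Measurable k) (n : ℕ) : Measurable (tailSqrt k n) :=
  measurable_const.indicator (measurableSet_lt measurable_const (by fun_prop))

lemma tendsto_mul_integral_tailSqrt (hk : Measurable k) (hkL : MemLp k 2 μ) :
    Tendsto (fun n : ℕ => n * ∫ x, tailSqrt k n x ∂μ) atTop (𝓝 0) := by
  have := tendsto_integral_of_dominated_convergence (μ := μ)
    (F := fun n x => n * tailSqrt k n x) (f := fun _ => 0) (fun x => k x ^ 2)
    (fun n => ((measurable_tailSqrt hk n).const_mul _).aestronglyMeasurable) hkL.integrable_sq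
    (fun n => .of_forall fun x => by
      rw [Real.norm_of_nonneg (mul_nonneg (Nat.cast_nonneg n) (tailSqrt_nonneg k n x))]
      exact mul_tailSqrt_le_sq k n x)
    (.of_forall fun x => tendsto_const_nhds.congr' <| by
      filter_upwards [eventually_tailSqrt_eq k x] with n hn; simp [hn])
  simpa only [integral_const_mul, integral_zero] using this

lemma tendsto_integral_tailSqrt_mul (hk : Measurable k) (hg : Measurable g) (hgL : MemLp g 2 μ) :
    Tendsto (fun n : ℕ => ∫ x, tailSqrt k n x * g x ^ 2 ∂μ) atTop (𝓝 0) := by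
  have := tendsto_integral_of_dominated_convergence (μ := μ)
    (F := fun n x => tailSqrt k n x * g x ^ 2) (f := fun _ => 0) (fun x => g x ^ 2)
    (fun n => ((measurable_tailSqrt hk n).mul (hg.pow_const 2)).aestronglyMeasurable)
    hgL.integrable_sq
    (fun n => .of_forall fun x => by
      rw [Real.norm_of_nonneg (mul_nonneg (tailSqrt_nonneg k n x) (sq_nonneg _))]
      exact mul_le_of_le_one_left (sq_nonneg _) (tailSqrt_le_one k n x))
    (.of_forall fun x => tendsto_const_nhds.congr' <| by
      filter_upwards [eventually_tailSqrt_eq k x] with n hn; simp [hn])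
  simpa only [integral_zero] using this

lemma tendsto_integral_truncSqrt_sq (hk : Measurable k) (hkL : MemLp k 2 μ) :
    Tendsto (fun n : ℕ => ∫ x, truncSqrt k n x ^ 2 ∂μ) atTop (𝓝 (∫ x, k x ^ 2 ∂μ)) :=
  tendsto_integral_of_dominated_convergence (fun x => k x ^ 2)
    (fun n => ((measurable_truncSqrt hk n).pow_const 2).aestronglyMeasurable) hkL.integrable_sq
    (fun n => .of_forall fun x => by
      rw [Real.norm_of_nonneg (sq_nonneg _)]; exact sq_le_sq.2 (abs_truncSqrt_le k n x))
    (.of_forall fun x => tendsto_const_nhds.congr' <| by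
      filter_upwards [eventually_truncSqrt_eq k x] with n hn; rw [hn])

lemma tendsto_integral_truncSqrt_mul (hk : Measurable k) (hg : Measurable g)
    (hkL : MemLp k 2 μ) (hgL : MemLp g 2 μ) :
    Tendsto (fun n : ℕ => ∫ x, truncSqrt k n x * g x ∂μ) atTop (𝓝 (∫ x, k x * g x ∂μ)) :=
  tendsto_integral_of_dominated_convergence (fun x => ‖k x * g x‖)
    (fun n => ((measurable_truncSqrt hk n).mul hg).aestronglyMeasurable)
    (hkL.integrable_mul hgL).norm
    (fun n => .of_forall fun x => by
      rw [norm_mul, norm_mul]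
      exact mul_le_mul_of_nonneg_right (abs_truncSqrt_le k n x) (norm_nonneg _))
    (.of_forall fun x => tendsto_const_nhds.congr' <| by
      filter_upwards [eventually_truncSqrt_eq k x] with n hn; rw [hn])

lemma tendsto_inv_mul_integral_truncSqrt_sq_mul (hk : Measurable k) (hg : Measurable g)
    (hgL : MemLp g 2 μ) :
    Tendsto (fun n : ℕ => (n : ℝ)⁻¹ * ∫ x, truncSqrt k n x ^ 2 * g x ^ 2 ∂μ) atTop (𝓝 0) := by
  have := tendsto_integral_of_dominated_convergence (μ := μ)
    (F := fun n x => (n : ℝ)⁻¹ * (truncSqrt k n x ^ 2 * g x ^ 2)) (f := fun _ => 0)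
    (fun x => g x ^ 2)
    (fun n => ((((measurable_truncSqrt hk n).pow_const 2).mul
      (hg.pow_const 2)).const_mul _).aestronglyMeasurable)
    hgL.integrable_sq
    (fun n => .of_forall fun x => by
      rw [Real.norm_of_nonneg (by positivity), ← mul_assoc]
      refine mul_le_of_le_one_left (sq_nonneg _) ?_
      exact inv_mul_le_one_of_le₀ (truncSqrt_sq_le k n x) (Nat.cast_nonneg n))
    (.of_forall fun x => by
      have h : Tendsto (fun n : ℕ => (n : ℝ)⁻¹ * (k x ^ 2 * g x ^ 2)) atTop (𝓝 0) := by
        simpa using (tendsto_inv_atTop_nhds_zero_nat (𝕜 := ℝ)).mul_const (k x ^ 2 * g x ^ 2)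
      refine h.congr' ?_
      filter_upwards [eventually_truncSqrt_eq k x] with n hn; rw [hn])
  simpa only [integral_const_mul, integral_zero] using this

lemma tendsto_inv_sqrt_nat : Tendsto (fun n : ℕ => (√(n : ℝ))⁻¹) atTop (𝓝 0) :=
  tendsto_inv_atTop_zero.comp (Real.tendsto_sqrt_atTop.comp tendsto_natCast_atTop_atTop)

/-- The product `k g²` need not be integrable; the truncation level `√n` absorbs the factor `1/√n`
and leaves `g²` as dominating function. -/
lemma tendsto_inv_sqrt_mul_integral_truncSqrt_mul (hk : Measurable k) (hg : Measurable g)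
    (hgL : MemLp g 2 μ) :
    Tendsto (fun n : ℕ => (√(n : ℝ))⁻¹ * ∫ x, |truncSqrt k n x| * g x ^ 2 ∂μ) atTop (𝓝 0) := by
  have := tendsto_integral_of_dominated_convergence (μ := μ)
    (F := fun n x => (√(n : ℝ))⁻¹ * (|truncSqrt k n x| * g x ^ 2)) (f := fun _ => 0)
    (fun x => g x ^ 2)
    (fun n => (((measurable_truncSqrt hk n).abs.mul
      (hg.pow_const 2)).const_mul _).aestronglyMeasurable)
    hgL.integrable_sq
    (fun n => .of_forall fun x => by
      rw [Real.norm_of_nonneg (by positivity), ← mul_assoc]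
      refine mul_le_of_le_one_left (sq_nonneg _) ?_
      exact inv_mul_le_one_of_le₀ (abs_truncSqrt_le_sqrt k n x) (Real.sqrt_nonneg _))
    (.of_forall fun x => by
      have h : Tendsto (fun n : ℕ => (√(n : ℝ))⁻¹ * (|k x| * g x ^ 2)) atTop (𝓝 0) := by
        simpa using tendsto_inv_sqrt_nat.mul_const (|k x| * g x ^ 2)
      refine h.congr' ?_
      filter_upwards [eventually_truncSqrt_eq k x] with n hn; rw [hn])
  simpa only [integral_const_mul, integral_zero] using this

/-- As `k` is centred, only the truncation error remains; it lives where `|k| > √n`, so `√n` times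
it is dominated by `k²`. -/
lemma tendsto_sqrt_mul_integral_truncSqrt [IsFiniteMeasure μ] (hk : Measurable k)
    (hkL : MemLp k 2 μ) (hk0 : ∫ x, k x ∂μ = 0) :
    Tendsto (fun n : ℕ => √(n : ℝ) * ∫ x, truncSqrt k n x ∂μ) atTop (𝓝 0) := by
  have hki : Integrable k μ := hkL.integrable one_le_two
  have hti : ∀ n, Integrable (truncSqrt k n) μ := fun n =>
    hki.mono (measurable_truncSqrt hk n).aestronglyMeasurable
      (.of_forall (abs_truncSqrt_le k n))
  have := tendsto_integral_of_dominated_convergence (μ := μ)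
    (F := fun n x => √(n : ℝ) * (truncSqrt k n x - k x)) (f := fun _ => 0) (fun x => k x ^ 2)
    (fun n => (((measurable_truncSqrt hk n).sub hk).const_mul _).aestronglyMeasurable)
    hkL.integrable_sq
    (fun n => .of_forall fun x => by
      rw [norm_mul, Real.norm_of_nonneg (Real.sqrt_nonneg _)]
      exact sqrt_mul_abs_sub_truncSqrt_le k n x)
    (.of_forall fun x => tendsto_const_nhds.congr' <| by
      filter_upwards [eventually_truncSqrt_eq k x] with n hn; simp [hn])
  simpa only [integral_const_mul, integral_zero, integral_sub (hti _) hki, hk0, sub_zero] using this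

end OneSided

/-! ### Asymptotic power along a local alternative. -/

namespace OneSided

variable {Ω : Type*} [MeasurableSpace Ω]

/-- A lower bound for the asymptotic power of the sum test along local alternatives with
tangent `g`. -/
lemma le_liminf_rejectionProb (P : ProbabilityMeasure Ω) (Q : ℕ → ProbabilityMeasure Ω)
    {k g : Ω → ℝ} {t c : ℝ} (hk : Measurable k) (hkL : MemLp k 2 (P : Measure Ω))
    (hk0 : ∫ x, k x ∂(P : Measure Ω) = 0) (hg : Measurable g) (hgL : MemLp g 2 (P : Measure Ω))
    (hfin : ∀ᶠ n : ℕ in atTop,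
      hellingerRemainder P (Q n) (fun x => t / √(n : ℝ) / 2 * g x) ≠ ⊤)
    (hρ : Tendsto (fun n : ℕ =>
      n * (hellingerRemainder P (Q n) (fun x => t / √(n : ℝ) / 2 * g x)).toReal ^ 2)
      atTop (𝓝 0))
    (hc : c < t * ∫ x, k x * g x ∂(P : Measure Ω) - ∫ x, k x ^ 2 ∂(P : Measure Ω)) :
    1 - 3 * (∫ x, k x ^ 2 ∂(P : Measure Ω)) /
        (t * ∫ x, k x * g x ∂(P : Measure Ω) - ∫ x, k x ^ 2 ∂(P : Measure Ω) - c) ^ 2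
      ≤ liminf (fun n : ℕ => rejectionProb (sumTest k c n) (Q n)) atTop := by
  set ρ : ℕ → ℝ := fun n =>
    (hellingerRemainder P (Q n) (fun x => t / √(n : ℝ) / 2 * g x)).toReal with hρdef
  set V := ∫ x, k x ^ 2 ∂(P : Measure Ω) with hV
  set a := ∫ x, k x * g x ∂(P : Measure Ω) with ha
  -- With `s = t/√n`, the comparison lemmas bound the scaled tail by `u`, the second moment by `v`
  -- and the scaled mean from below by `m`.
  let u : ℕ → ℝ := fun n => 3 * (n * ∫ x, tailSqrt k n x ∂(P : Measure Ω))
    + 3 / 4 * t ^ 2 * ∫ x, tailSqrt k n x * g x ^ 2 ∂(P : Measure Ω) + 3 * (n * ρ n ^ 2)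
  let v : ℕ → ℝ := fun n => 3 * ∫ x, truncSqrt k n x ^ 2 ∂(P : Measure Ω)
    + 3 / 4 * t ^ 2 * ((n : ℝ)⁻¹ * ∫ x, truncSqrt k n x ^ 2 * g x ^ 2 ∂(P : Measure Ω))
    + 3 * (n * ρ n ^ 2)
  let m : ℕ → ℝ := fun n => √(n : ℝ) * ∫ x, truncSqrt k n x ∂(P : Measure Ω)
    + t * ∫ x, truncSqrt k n x * g x ∂(P : Measure Ω)
    - ∫ x, truncSqrt k n x ^ 2 ∂(P : Measure Ω)
    - t ^ 2 / 2 * ((√(n : ℝ))⁻¹ * ∫ x, |truncSqrt k n x| * g x ^ 2 ∂(P : Measure Ω))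
    - 3 * (n * ρ n ^ 2)
  have hu : Tendsto u atTop (𝓝 0) := by
    simpa using (((tendsto_mul_integral_tailSqrt hk hkL).const_mul 3).add
      ((tendsto_integral_tailSqrt_mul hk hg hgL).const_mul (3 / 4 * t ^ 2))).add (hρ.const_mul 3)
  have hv : Tendsto v atTop (𝓝 (3 * V)) := by
    simpa using (((tendsto_integral_truncSqrt_sq hk hkL).const_mul 3).add
      ((tendsto_inv_mul_integral_truncSqrt_sq_mul hk hg hgL).const_mul (3 / 4 * t ^ 2))).add
      (hρ.const_mul 3)
  have hm : Tendsto m atTop (𝓝 (t * a - V)) := by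
    simpa using ((((tendsto_sqrt_mul_integral_truncSqrt hk hkL hk0).add
      ((tendsto_integral_truncSqrt_mul hk hg hkL hgL).const_mul t)).sub
      (tendsto_integral_truncSqrt_sq hk hkL)).sub
      ((tendsto_inv_sqrt_mul_integral_truncSqrt_mul hk hg hgL).const_mul (t ^ 2 / 2))).sub
      (hρ.const_mul 3)
  have hlim : Tendsto (fun n => 1 - u n - v n / (m n - c) ^ 2) atTop
      (𝓝 (1 - 3 * V / (t * a - V - c) ^ 2)) := by
    have hne : (t * a - V - c) ^ 2 ≠ 0 := pow_ne_zero 2 (sub_pos.2 hc).ne'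
    simpa using (hu.const_sub 1).sub (hv.div ((hm.sub_const c).pow 2) hne)
  have hev : ∀ᶠ n : ℕ in atTop,
      1 - u n - v n / (m n - c) ^ 2 ≤ rejectionProb (sumTest k c n) (Q n) := by
    filter_upwards [hfin, hm.eventually_const_lt hc, eventually_gt_atTop 0] with n hn hmn hn0
    have hnR : (0 : ℝ) < n := by exact_mod_cast hn0
    have hsq : √(n : ℝ) ^ 2 = n := Real.sq_sqrt hnR.le
    have hs0 : 0 < √(n : ℝ) := Real.sqrt_pos.2 hnR
    have hts : (t / √(n : ℝ)) ^ 2 = t ^ 2 * (n : ℝ)⁻¹ := by rw [div_pow, hsq, div_eq_mul_inv]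
    have htail : n * (Q n : Measure Ω).real {x | √(n : ℝ) < |k x|} ≤ u n := by
      have h := integral_le_of_hellingerRemainder P (Q n) hg hgL hn (measurable_tailSqrt hk n)
        (tailSqrt_nonneg k n) (tailSqrt_le_one k n)
      have he : ∫ x, tailSqrt k n x ∂(Q n : Measure Ω)
          = (Q n : Measure Ω).real {x | √(n : ℝ) < |k x|} := by
        rw [tailSqrt, integral_indicator_const _ (measurableSet_lt measurable_const (by fun_prop)),
          smul_eq_mul, mul_one]
      rw [he, hts] at h
      refine (mul_le_mul_of_nonneg_left h hnR.le).trans_eq ?_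
      simp only [u, hρdef]
      field_simp
    have hvar : ∫ x, truncSqrt k n x ^ 2 ∂(Q n : Measure Ω) ≤ v n := by
      have h := integral_le_of_hellingerRemainder P (Q n) hg hgL hn
        ((measurable_truncSqrt hk n).pow_const 2) (fun x => sq_nonneg _) (truncSqrt_sq_le k n)
      rw [hts] at h
      refine h.trans_eq ?_
      simp only [v, hρdef]
      ring
    -- With `δ = 1/√n` and `B = √n`, scaling by `√n` turns the remainder into `3 n ρ²`, which
    -- vanishes; the price is the second moment, whence the `- V` in the limit of `m`.
    have hmean : m n ≤ √(n : ℝ) * ∫ x, truncSqrt k n x ∂(Q n : Measure Ω) := by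
      have h := le_integral_of_hellingerRemainder P (Q n) hg hgL hn (measurable_truncSqrt hk n)
        (abs_truncSqrt_le_sqrt k n) (inv_pos.2 hs0)
      rw [hts, inv_inv] at h
      refine Eq.trans_le ?_ (mul_le_mul_of_nonneg_left h hs0.le)
      simp only [m, hρdef]
      rw [← hsq, Real.sqrt_sq hs0.le]
      field_simp
      ring
    have hpos : 0 < m n - c := sub_pos.2 hmn
    have hmain := one_sub_le_rejectionProb (Q n) hk hn0 (b := √(n : ℝ)) (hmn.trans_le hmean)
    refine le_trans ?_ hmain
    refine sub_le_sub (sub_le_sub_left htail 1) ?_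
    refine div_le_div₀ ((integral_nonneg fun _ => sq_nonneg _).trans hvar) hvar (by positivity) ?_
    exact pow_le_pow_left₀ hpos.le (sub_le_sub_right hmean c) 2
  rw [← hlim.liminf_eq]
  exact liminf_le_liminf hev hlim.isBoundedUnder_ge
    (isBoundedUnder_of ⟨1, fun n => (rejectionProb_sumTest_mem_Icc k c n (Q n)).2⟩).isCoboundedUnder_ge

end OneSided

/-! ### Cone projection, local paths and null sequences. -/

namespace OneSided

/-- The best approximation of `κ` in a closed convex cone is orthogonal to the residual. -/
lemma IsBestApprox.inner_self_eq {E : Type*} [NormedAddCommGroup E] [InnerProductSpace ℝ E]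
    {C : ProperCone ℝ E} {κ κhat : E} (h : IsBestApprox (C : Set E) κ κhat) :
    inner ℝ κ κhat = ‖κhat‖ ^ 2 := by
  have hbdd : BddBelow (Set.range fun w : (C : Set E) => ‖κ - w‖) :=
    ⟨0, by rintro _ ⟨w, rfl⟩; exact norm_nonneg _⟩
  have : Nonempty (C : Set E) := ⟨⟨κhat, h.1⟩⟩
  have hinf : ‖κ - κhat‖ = ⨅ w : (C : Set E), ‖κ - w‖ :=
    le_antisymm (le_ciInf fun w => h.2 w w.2) (ciInf_le hbdd ⟨κhat, h.1⟩)
  have hcv : Convex ℝ (C : Set E) := C.toPointedCone.toConvexCone.convex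
  have hle := (norm_eq_iInf_iff_real_inner_le_zero hcv h.1).1 hinf
  -- The variational inequality at `0` and at `2 κhat` gives the two opposite inequalities.
  have h0 := hle 0 C.zero_mem
  have h2 := hle (κhat + κhat) (C.add_mem h.1 h.1)
  rw [zero_sub, inner_neg_right, inner_sub_left, real_inner_self_eq_norm_sq] at h0
  rw [add_sub_cancel_right, inner_sub_left, real_inner_self_eq_norm_sq] at h2
  linarith

variable {Ω : Type*} [MeasurableSpace Ω]

lemma tendsto_div_sqrt_nat {t : ℝ} (ht : 0 < t) :
    Tendsto (fun n : ℕ => t / √(n : ℝ)) atTop (𝓝[>] 0) := by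
  refine tendsto_nhdsWithin_iff.2 ⟨?_, ?_⟩
  · simpa [div_eq_mul_inv] using tendsto_inv_sqrt_nat.const_mul t
  · filter_upwards [eventually_gt_atTop 0] with n hn
    have : (0 : ℝ) < n := by exact_mod_cast hn
    exact div_pos ht (Real.sqrt_pos.2 this)

/-- Needed because `toReal` would turn an infinite remainder into 0. -/
lemma IsLocalPath.eventually_hellingerRemainder_ne_top {𝓜 : Set (ProbabilityMeasure Ω)}
    {P : ProbabilityMeasure Ω} {g : Lp ℝ 2 (P : Measure Ω)} {path : ℝ → ProbabilityMeasure Ω}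
    (h : IsLocalPath 𝓜 P g path) :
    ∀ᶠ s in 𝓝[>] (0 : ℝ), hellingerRemainder P (path s) (fun x => s / 2 * g x) ≠ ⊤ := by
  filter_upwards [h.2.eventually_lt_const zero_lt_one] with s hs htop
  rw [htop, ENNReal.top_div_of_ne_top ENNReal.ofReal_ne_top] at hs
  exact absurd hs (by simp)

/-- At `s = t/√n` the quantity equals `t²` times the square of the remainder divided by `s`. -/
lemma IsLocalPath.tendsto_mul_hellingerRemainder_sq {𝓜 : Set (ProbabilityMeasure Ω)}
    {P : ProbabilityMeasure Ω} {g : Lp ℝ 2 (P : Measure Ω)} {path : ℝ → ProbabilityMeasure Ω}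
    (h : IsLocalPath 𝓜 P g path) {t : ℝ} (ht : 0 < t) :
    Tendsto (fun n : ℕ => n * (hellingerRemainder P (path (t / √(n : ℝ)))
      (fun x => t / √(n : ℝ) / 2 * g x)).toReal ^ 2) atTop (𝓝 0) := by
  have h1 := (ENNReal.tendsto_toReal ENNReal.zero_ne_top).comp
    (h.2.comp (tendsto_div_sqrt_nat ht))
  have h2 := (h1.pow 2).const_mul (t ^ 2)
  simp only [ENNReal.toReal_zero, ne_eq, OfNat.ofNat_ne_zero, not_false_eq_true, zero_pow,
    mul_zero] at h2
  refine h2.congr' ?_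
  filter_upwards [eventually_gt_atTop 0] with n hn
  have hnR : (0 : ℝ) < n := by exact_mod_cast hn
  have hs0 : 0 < √(n : ℝ) := Real.sqrt_pos.2 hnR
  simp only [Function.comp_apply, ENNReal.toReal_div, ENNReal.toReal_ofReal (div_pos ht hs0).le]
  rw [div_pow, div_pow, Real.sq_sqrt hnR.le]
  field_simp

/-- Local alternatives in a direction orthogonal to the gradient belong to the null
hypothesis. -/
lemma mem_nullJ_of_inner_eq_zero {T : ProbabilityMeasure Ω → ℝ} {P : ProbabilityMeasure Ω}
    {G : Set (Lp ℝ 2 (P : Measure Ω))}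
    {path : Lp ℝ 2 (P : Measure Ω) → ℝ → ProbabilityMeasure Ω} {κ g : Lp ℝ 2 (P : Measure Ω)}
    (hT : HasGradient T P G path κ) (hg : g ∈ G) (hκg : inner ℝ κ g = 0) {t : ℝ} (ht : 0 < t) :
    (fun n : ℕ => path g (t / √(n : ℝ))) ∈ nullJ T P G path := by
  refine ⟨⟨g, hg, t, ht, rfl⟩, ?_⟩
  have h1 := ((hT g hg).comp_tendsto (tendsto_div_sqrt_nat ht)).tendsto_div_nhds_zero.const_mul t
  rw [mul_zero] at h1
  refine h1.congr' ?_
  filter_upwards [eventually_gt_atTop 0] with n hn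
  have hnR : (0 : ℝ) < n := by exact_mod_cast hn
  have hs0 : 0 < √(n : ℝ) := Real.sqrt_pos.2 hnR
  simp only [Function.comp_apply, hκg, mul_zero, add_zero]
  field_simp

lemma integral_mul_eq_inner_of_ae_eq {μ : Measure Ω} {f : Lp ℝ 2 μ} {k : Ω → ℝ}
    (hk : k =ᵐ[μ] f) (g : Lp ℝ 2 μ) : ∫ x, k x * g x ∂μ = inner ℝ f g := by
  rw [L2.inner_def]
  refine integral_congr_ae ?_
  filter_upwards [hk] with x hx
  rw [hx]; simp [mul_comm]

end OneSided

theorem mainTheorem9 {Ω : Type*} [MeasurableSpace Ω]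
    -- the model, the functional (its values off the model are irrelevant), the fixed law
    (𝓜 : Set (ProbabilityMeasure Ω)) (T : ProbabilityMeasure Ω → ℝ)
    (P : ProbabilityMeasure Ω) (hP : P ∈ 𝓜)
    -- the tangent set is a closed convex cone with vertex at 0
    (Ghat : ProperCone ℝ (Lp ℝ 2 (P : Measure Ω)))
    (hG : (Ghat : Set (Lp ℝ 2 (P : Measure Ω))) = OneSided.tangentSet 𝓜 P)
    -- the local alternatives P_{g,s} in 𝓜
    (path : Lp ℝ 2 (P : Measure Ω) → ℝ → ProbabilityMeasure Ω)
    (hpath : ∀ g ∈ Ghat, OneSided.IsLocalPath 𝓜 P g (path g))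
    -- differentiability of the functional
    (κ : Lp ℝ 2 (P : Measure Ω))
    (hT : OneSided.HasGradient T P (Ghat : Set (Lp ℝ 2 (P : Measure Ω))) path κ)
    -- the cone projection of κ, and any measurable version k of it
    (κhat : Lp ℝ 2 (P : Measure Ω))
    (hκhat : OneSided.IsBestApprox (Ghat : Set (Lp ℝ 2 (P : Measure Ω))) κ κhat)
    (k : Ω → ℝ) (hk : Measurable k) (hkκ : k =ᵐ[(P : Measure Ω)] κhat)
    -- the level and the upper standard normal point
    (α u : ℝ) (hα : α ∈ Set.Ioo (0 : ℝ) 1) (hu : cdf (gaussianReal 0 1) (-u) = α)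
    (hg₀ : ∃ g₀ ∈ Ghat, inner ℝ κ g₀ ≤ 0 ∧ 0 < inner ℝ κhat g₀) :
    IsLUB
      ((fun Q : ℕ → ProbabilityMeasure Ω =>
          liminf (fun n : ℕ => OneSided.rejectionProb (OneSided.sumTest k (‖κhat‖ * u) n) (Q n))
            atTop) ''
        OneSided.nullJ T P (Ghat : Set (Lp ℝ 2 (P : Measure Ω))) path)
      1 := by
  have hIcc := OneSided.rejectionProb_sumTest_mem_Icc k (‖κhat‖ * u)
  refine ⟨?_, fun b hb => ?_⟩
  · rintro _ ⟨Q, -, rfl⟩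
    refine liminf_le_of_le (isBoundedUnder_of ⟨0, fun n => (hIcc n (Q n)).1⟩) fun b hb => ?_
    obtain ⟨n, hn⟩ := hb.exists
    exact hn.trans (hIcc n (Q n)).2
  obtain ⟨g₀, hg₀, hκg₀, hpos⟩ := hg₀
  have hne : κhat ≠ 0 := by rintro rfl; simp at hpos
  have hnorm : 0 < ‖κhat‖ ^ 2 := by have := norm_pos_iff.2 hne; positivity
  -- move `g₀` along `κhat` until it is orthogonal to the gradient
  obtain ⟨g, hg, hκg, hκhatg⟩ : ∃ g ∈ Ghat, inner ℝ κ g = 0 ∧ 0 < inner ℝ κhat g := by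
    -- The coefficient `r` solves `⟨κ|g₀⟩ + r ‖κhat‖² = 0`; its sign keeps the sum in the cone.
    have hr : 0 ≤ -inner ℝ κ g₀ / ‖κhat‖ ^ 2 := div_nonneg (neg_nonneg.2 hκg₀) hnorm.le
    refine ⟨g₀ + (-inner ℝ κ g₀ / ‖κhat‖ ^ 2) • κhat,
      Ghat.add_mem hg₀ (Ghat.smul_mem hκhat.1 hr), ?_, ?_⟩
    · rw [inner_add_right, inner_smul_right, hκhat.inner_self_eq]
      field_simp
      ring
    · rw [inner_add_right, inner_smul_right, real_inner_self_eq_norm_sq]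
      have := mul_nonneg hr hnorm.le
      linarith
  have hkL : MemLp k 2 (P : Measure Ω) := (Lp.memLp κhat).ae_eq hkκ.symm
  have hk0 : ∫ x, k x ∂(P : Measure Ω) = 0 := by
    have : κhat ∈ OneSided.tangentSet 𝓜 P := hG ▸ hκhat.1
    rw [integral_congr_ae hkκ]
    exact this.1
  -- The power bound tends to 1 as `t → ∞`; every large `t` gives a null sequence, so an upper bound
  -- `b` of the image is at least 1.
  have hlow : Tendsto (fun t : ℝ => 1 - 3 * (∫ x, k x ^ 2 ∂(P : Measure Ω)) /
      (t * inner ℝ κhat g - (∫ x, k x ^ 2 ∂(P : Measure Ω)) - ‖κhat‖ * u) ^ 2) atTop (𝓝 1) := by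
    have h1 : Tendsto (fun t : ℝ => t * inner ℝ κhat g - (∫ x, k x ^ 2 ∂(P : Measure Ω))
        - ‖κhat‖ * u) atTop atTop := by
      simp only [sub_eq_add_neg, add_assoc]
      exact tendsto_atTop_add_const_right _ _ (tendsto_id.atTop_mul_const hκhatg)
    simpa using ((tendsto_const_nhds (x := 3 * ∫ x, k x ^ 2 ∂(P : Measure Ω))).div_atTop
      ((tendsto_pow_atTop two_ne_zero).comp h1)).const_sub 1
  refine le_of_tendsto hlow ?_
  have hbig : ∀ᶠ t : ℝ in atTop,
      ‖κhat‖ * u + ∫ x, k x ^ 2 ∂(P : Measure Ω) < t * inner ℝ κhat g :=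
    (tendsto_id.atTop_mul_const hκhatg).eventually_gt_atTop _
  filter_upwards [hbig, eventually_gt_atTop 0] with t htbig ht
  refine le_trans ?_ (hb ⟨_, OneSided.mem_nullJ_of_inner_eq_zero hT hg hκg ht, rfl⟩)
  have hloc := hpath g hg
  rw [← OneSided.integral_mul_eq_inner_of_ae_eq hkκ g] at htbig ⊢
  exact OneSided.le_liminf_rejectionProb P (fun n => path g (t / √(n : ℝ))) hk hkL hk0
    (Lp.stronglyMeasurable g).measurable (Lp.memLp g)
    ((OneSided.tendsto_div_sqrt_nat ht).eventually hloc.eventually_hellingerRemainder_ne_top)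
    (hloc.tendsto_mul_hellingerRemainder_sq ht) (by linarith)
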